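/- **Theorem.** A batched counter is a shared object with operations $\mathrm{update}(v)$, $v\in\mathbb{N}$, which returns nothing, and $\mathrm{read}()$. Its sequential specification says that a read returns the sum of the arguments of all updates that precede it ($0$ if there are none). Consider deterministic algorithms that implement the object for $n$ asynchronous processes, each of which may invoke both operations, from atomic single-writer multi-reader (SWMR) registers (any number of registers, with arbitrary sets of values). Such an implementation is linearizable if the history of every well-formed execution has a linearization in the sequential specification. It is bounded wait-free if, for every operation and argument, there is a bound on the number of its own steps within which a process that invokes this operation gets a response, regardless of the steps of the other processes. For any linearizable, bounded wait-free implementation of a batched counter for $n$ processes from SWMR registers, the step complexity of update is $\Omega(n)$. That is, there are constants $c>0$ and $N$ such that for all $n\ge N$ and every such implementation for $n$ processes, the step complexity of update, i.e. the supremum over all executions of the number of steps that a process takes during a single update operation, is at least $c\,n$. This holds even if only accesses to the registers are counted as steps. -/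

import Mathlib

open scoped NNReal ENNReal

universe u

namespace SharedMemory

/-! ## Histories, linearizability -/

/-- Events of a history: process `p` invokes operation `o`; process `p` gets the response `r`. -/
inductive Event (n : ℕ) (Op Ret : Type) where
  | inv (p : Fin n) (o : Op)
  | res (p : Fin n) (r : Ret)

/-- The process that an event belongs to. -/
def Event.proc {n : ℕ} {Op Ret : Type} : Event n Op Ret → Fin n
  | .inv p _ => p
  | .res p _ => p

/-- A complete operation: an invocation `inv_p(op)` followed immediately by its response
`rsp_p(op) → ret`. -/
structure SeqOp (n : ℕ) (Op Ret : Type) where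
  proc : Fin n
  op : Op
  ret : Ret

/-- A (complete) sequential history is a list of operations; a sequential specification is the set
of the allowed ones. -/
abbrev SeqSpec (n : ℕ) (Op Ret : Type) := Set (List (SeqOp n Op Ret))

section History

variable {n : ℕ} {Op Ret : Type}

/-- Operations of a history `H` are identified with the positions of their invocations.
`Returns H i j r`: the operation invoked at position `i` of `H` has its response at position `j`,
with return value `r`. -/
def Returns (H : List (Event n Op Ret)) (i j : ℕ) (r : Ret) : Prop :=
  ∃ (p : Fin n) (o : Op), H[i]? = some (.inv p o) ∧ H[j]? = some (.res p r) ∧ i < j ∧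
    ∀ k, i < k → k < j → ∀ e, H[k]? = some e → e.proc ≠ p

/-- The partial order `≺_H` of a history: the response of the operation invoked at `i` comes before
the invocation at `j`. -/
def Precedes (H : List (Event n Op Ret)) (i j : ℕ) : Prop :=
  ∃ (i' : ℕ) (r : Ret), Returns H i i' r ∧ i' < j

/-- `L` is a linearization of `H`: a sequence of complete operations, each labelled with the position
of its invocation in `H`, without repetitions. All operations that return in `H` occur in it, with
their return values; a pending operation either does not occur (it is removed) or occurs with some
return value (it is completed); and the order of `L` respects `≺_H`. -/
structure IsLinearization (H : List (Event n Op Ret)) (L : List (ℕ × SeqOp n Op Ret)) : Prop where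
  nodup : (L.map Prod.fst).Nodup
  invoked : ∀ x ∈ L, H[x.1]? = some (.inv x.2.proc x.2.op)
  returned : ∀ i j r, Returns H i j r → ∃ a, (i, a) ∈ L ∧ a.ret = r
  order : L.Pairwise fun x y => ¬ Precedes H y.1 x.1

/-- The history `H` has a linearization in the sequential specification. -/
def HistoryLinearizable (spec : SeqSpec n Op Ret) (H : List (Event n Op Ret)) : Prop :=
  ∃ L : List (ℕ × SeqOp n Op Ret), IsLinearization H L ∧ L.map Prod.snd ∈ spec

end History

/-! ## Algorithms over single-writer multi-reader registers -/

/-- What a process `p` with a pending operation does in its next step; every step may come with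
local computation, i.e. an arbitrary change of the local state.
* `read r k`: read register `r` (any register), and change the local state according to the value;
* `write r own v k`: write `v` into `r`, a register that `p` owns;
* `compute k`: a purely local (possibly empty) step;
* `respond x k`: return `x` from the operation. -/
inductive Action {n : ℕ} {Reg : Type u} (owner : Reg → Fin n) (Val State : Type u) (Ret : Type)
    (p : Fin n) where
  | read (r : Reg) (k : Val → State)
  | write (r : Reg) (own : owner r = p) (v : Val) (k : State)
  | compute (k : State)
  | respond (x : Ret) (k : State)

/-- A deterministic algorithm for `n` processes that implements the operations `Op`, with return
values in `Ret`, from atomic SWMR registers. Every register is owned by one process, which is the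
only one that can write into it; every process can read it. There may be arbitrarily many registers,
and the sets of register values and of local states are arbitrary. -/
structure Algorithm (n : ℕ) (Op Ret : Type) where
  /-- the names of the registers -/
  Reg : Type u
  /-- the single writer of each register -/
  owner : Reg → Fin n
  /-- register values -/
  Val : Type u
  /-- local states; they persist from one operation of a process to its next -/
  State : Type u
  initVal : Reg → Val
  initState : Fin n → State
  /-- the local state in which process `p` begins an invoked operation -/
  start : (p : Fin n) → State → Op → State
  /-- the next step of process `p` when it has a pending operation -/
  next : (p : Fin n) → State → Action owner Val State Ret p

/-- A pending operation, with the number of steps that its process has taken since the invocation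
(the invocation itself is not counted), and the number of those that accessed a register. -/
structure Pending (Op : Type) where
  op : Op
  steps : ℕ
  accesses : ℕ

namespace Algorithm

variable {n : ℕ} {Op Ret : Type}

/-- A global state: register contents, local states, and the pending operation of each process
(`none` for an idle process). -/
structure Config (A : Algorithm.{u} n Op Ret) where
  reg : A.Reg → A.Val
  loc : Fin n → A.State
  pending : Fin n → Option (Pending Op)

variable (A : Algorithm.{u} n Op Ret)

/-- The initial global state. -/
def initial : A.Config where
  reg := A.initVal
  loc := A.initState
  pending := fun _ => none

open Classical in
/-- `A.Step c e c'`: some process takes a step from `c` to `c'`; `e` is the event that the step adds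
to the history, if any. A process can invoke any operation, provided that it is idle (so all
histories are well-formed); otherwise the step is determined by the process that takes it. -/
inductive Step : A.Config → Option (Event n Op Ret) → A.Config → Prop
  | invoke (c : A.Config) (p : Fin n) (o : Op) (hp : c.pending p = none) :
      Step c (some (.inv p o))
        { reg := c.reg
          loc := Function.update c.loc p (A.start p (c.loc p) o)
          pending := Function.update c.pending p (some ⟨o, 0, 0⟩) }
  | read (c : A.Config) (p : Fin n) (a : Pending Op) (hp : c.pending p = some a)
      (r : A.Reg) (k : A.Val → A.State) (hk : A.next p (c.loc p) = .read r k) :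
      Step c none
        { reg := c.reg
          loc := Function.update c.loc p (k (c.reg r))
          pending := Function.update c.pending p (some ⟨a.op, a.steps + 1, a.accesses + 1⟩) }
  | write (c : A.Config) (p : Fin n) (a : Pending Op) (hp : c.pending p = some a)
      (r : A.Reg) (own : A.owner r = p) (v : A.Val) (k : A.State)
      (hk : A.next p (c.loc p) = .write r own v k) :
      Step c none
        { reg := Function.update c.reg r v
          loc := Function.update c.loc p k
          pending := Function.update c.pending p (some ⟨a.op, a.steps + 1, a.accesses + 1⟩) }
  | compute (c : A.Config) (p : Fin n) (a : Pending Op) (hp : c.pending p = some a)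
      (k : A.State) (hk : A.next p (c.loc p) = .compute k) :
      Step c none
        { reg := c.reg
          loc := Function.update c.loc p k
          pending := Function.update c.pending p (some ⟨a.op, a.steps + 1, a.accesses⟩) }
  | respond (c : A.Config) (p : Fin n) (a : Pending Op) (hp : c.pending p = some a)
      (x : Ret) (k : A.State) (hk : A.next p (c.loc p) = .respond x k) :
      Step c (some (.res p x))
        { reg := c.reg
          loc := Function.update c.loc p k
          pending := Function.update c.pending p none }

/-- `A.Exec H c`: some (finite, well-formed) execution of `A` from the initial state has the
history `H` and ends in the state `c`. -/
inductive Exec : List (Event n Op Ret) → A.Config → Prop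
  | initial : Exec [] A.initial
  | step {H : List (Event n Op Ret)} {c c' : A.Config} {e : Option (Event n Op Ret)} :
      Exec H c → A.Step c e c' → Exec (H ++ e.toList) c'

/-- `A` is a linearizable implementation of the sequential specification. -/
def IsLinearizable (spec : SeqSpec n Op Ret) : Prop :=
  ∀ (H : List (Event n Op Ret)) (c : A.Config), A.Exec H c → HistoryLinearizable spec H

/-- Bounded wait-freedom: for every operation (with its argument) there is a bound on the number of
steps that a process takes while such an operation of its is pending, in any execution. As a process
with a pending operation can always take a step, the operation returns after at most one more. -/
def BoundedWaitFree : Prop :=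
  ∀ o : Op, ∃ B : ℕ, ∀ (H : List (Event n Op Ret)) (c : A.Config), A.Exec H c →
    ∀ (p : Fin n) (a : Pending Op), c.pending p = some a → a.op = o → a.steps ≤ B

/-- The step complexity of a set `K` of operations: the largest number of steps that a process takes
during a single execution of an operation in `K`. Only accesses to the registers count; the
invocation, the response and local steps are free, which makes lower bounds stronger. -/
noncomputable def stepComplexity (K : Set Op) : ℕ∞ :=
  ⨆ (H : List (Event n Op Ret)) (c : A.Config) (_ : A.Exec H c) (p : Fin n) (a : Pending Op)
    (_ : c.pending p = some a) (_ : a.op ∈ K), (a.accesses : ℕ∞)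

end Algorithm

/-! ## The batched counter -/

/-- The operations of a batched counter. -/
inductive CounterOp where
  | update (v : ℕ)
  | read

/-- The return values of a batched counter: an update returns nothing, i.e. just `ack`. -/
inductive CounterRet where
  | ack
  | val (s : ℕ)

/-- The amount that an operation adds to the counter. -/
def CounterOp.amount : CounterOp → ℕ
  | .update v => v
  | .read => 0

/-- The update operations. -/
def CounterOp.updates : Set CounterOp := Set.range CounterOp.update

/-- Sequential specification of the batched counter: an update returns nothing, and a read returns
the sum of the values passed to the updates before it. -/
def batchedCounter (n : ℕ) : SeqSpec n CounterOp CounterRet :=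
  { S | ∀ (k : ℕ) (a : SeqOp n CounterOp CounterRet), S[k]? = some a →
      match a.op with
      | .update _ => a.ret = .ack
      | .read => a.ret = .val ((S.take k).map fun b => b.op.amount).sum }

end SharedMemory

/-! ### Solo moves of a process: locality and commutation -/

namespace SharedMemory

namespace Algorithm

variable {n : ℕ} {Op Ret : Type} {A : Algorithm.{u} n Op Ret}

/-! Half of the processes, `M`, have a pending read; the other half, `Q`, make complete updates one
at a time. Process `q` always adds `q + 1`; since these amounts are positive and distinct, partial
sums betray the order of two updates. An adversary maintains the invariant `Stage`: the last update
is by `p`, and a pending read that responded now would have to count everything up to and including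
it.

In each round a reader `i` takes one step, and then some `q` updates, where the updates of `p` and
`q` read neither each other nor `i`. The step of `i` reads at most one register, so it misses `p` or
`q`. Registers have single writers, hence moves of processes that do not read each other commute
(`Move.swap`), and the same configuration also arises with the update of `q` before that of `p`. A
response must be a partial sum for both orders (`read_value_of_linearizable`). If it missed `q` in
the order `p`, `q`, the old invariant would make it the sum ending with `p`, which is no partial sum
in the order `q`, `p`. So the invariant passes to `q` (`Stage.next`). A reader about to respond
would have to return the same value before and after the update of `q`, which the invariant forbids;
so readers take arbitrarily many steps, contradicting bounded wait-freedom.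

Such `i` and `q` exist if updates access at most `k` registers and `Q` has more than `14 * k + 4`
elements: at most half of the candidates are read by more than `2 * k` updaters
(`two_mul_card_filter_le`), and a round spoils only the read sets of `q` and of the updaters that
read `i` or `q`. Thus `k` is linear in the number of processes. -/

theorem Config.ext' {c d : A.Config} (hr : ∀ r, c.reg r = d.reg r)
    (hl : ∀ x, c.loc x = d.loc x) (hp : ∀ x, c.pending x = d.pending x) : c = d := by
  cases c; cases d
  simp only [Config.mk.injEq]
  exact ⟨funext hr, funext hl, funext hp⟩

/-- `c` and `d` agree on the private part of `p` and on the registers of `p` and of the processes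
in `F`. -/
def AgreeOn (p : Fin n) (F : Finset (Fin n)) (c d : A.Config) : Prop :=
  c.loc p = d.loc p ∧ c.pending p = d.pending p ∧
    ∀ r, (A.owner r = p ∨ A.owner r ∈ F) → c.reg r = d.reg r

/-- `c` and `d` agree on everything that does not belong to `p`. -/
def AgreeOff (p : Fin n) (c d : A.Config) : Prop :=
  (∀ x, x ≠ p → c.loc x = d.loc x ∧ c.pending x = d.pending x) ∧
    ∀ r, A.owner r ≠ p → c.reg r = d.reg r

/-- The configuration `d`, with everything that belongs to `p` taken from `c`. -/
def splice (p : Fin n) (c d : A.Config) : A.Config where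
  reg r := if A.owner r = p then c.reg r else d.reg r
  loc x := if x = p then c.loc x else d.loc x
  pending x := if x = p then c.pending x else d.pending x

/-- Process `p` alone can go from `c` to `c'`, producing the events `H` and reading only registers of
processes in `F` and its own; and it does the same in every reachable configuration that agrees with
`c` on what it reads. -/
def Move (p : Fin n) (F : Finset (Fin n)) (c : A.Config) (H : List (Event n Op Ret))
    (c' : A.Config) : Prop :=
  AgreeOff p c c' ∧
    ∀ d, AgreeOn p F c d → ∀ H₀, A.Exec H₀ d → A.Exec (H₀ ++ H) (splice p c' d)

theorem splice_eq_of_agreeOff {p : Fin n} {c c' : A.Config} (h : AgreeOff p c c') :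
    splice p c' c = c' := by
  refine Config.ext' (fun r => ?_) (fun x => ?_) (fun x => ?_)
  · by_cases hr : A.owner r = p
    · simp [splice, hr]
    · simp [splice, hr, h.2 r hr]
  · by_cases hx : x = p
    · simp [splice, hx]
    · simp [splice, hx, (h.1 x hx).1]
  · by_cases hx : x = p
    · simp [splice, hx]
    · simp [splice, hx, (h.1 x hx).2]

theorem AgreeOn.refl (p : Fin n) (F : Finset (Fin n)) (c : A.Config) : AgreeOn p F c c :=
  ⟨rfl, rfl, fun _ _ => rfl⟩

theorem agreeOff_splice (p : Fin n) (c d : A.Config) : AgreeOff p d (splice p c d) := by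
  refine ⟨fun x hx => ?_, fun r hr => ?_⟩
  · simp [splice, hx]
  · simp [splice, hr]

theorem Move.exec {p : Fin n} {F : Finset (Fin n)} {c c' : A.Config} {H H₀ : List (Event n Op Ret)}
    (h : Move p F c H c') (h₀ : A.Exec H₀ c) : A.Exec (H₀ ++ H) c' := by
  have := h.2 c (AgreeOn.refl ..) H₀ h₀
  rwa [splice_eq_of_agreeOff h.1] at this

theorem Move.refl (p : Fin n) (F : Finset (Fin n)) (c : A.Config) : Move p F c [] c := by
  refine ⟨⟨fun _ _ => ⟨rfl, rfl⟩, fun _ _ => rfl⟩, fun d hd H₀ h₀ => ?_⟩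
  have : splice p c d = d := by
    refine Config.ext' (fun r => ?_) (fun x => ?_) (fun x => ?_)
    · by_cases hr : A.owner r = p
      · simp [splice, hr, hd.2.2 r (.inl hr)]
      · simp [splice, hr]
    · by_cases hx : x = p
      · subst hx; simp [splice, hd.1]
      · simp [splice, hx]
    · by_cases hx : x = p
      · subst hx; simp [splice, hd.2.1]
      · simp [splice, hx]
  rw [this, List.append_nil]
  exact h₀

theorem Move.mono {p : Fin n} {F G : Finset (Fin n)} {c c' : A.Config} {H : List (Event n Op Ret)}
    (h : Move p F c H c') (hFG : F ⊆ G) : Move p G c H c' :=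
  ⟨h.1, fun d hd => h.2 d ⟨hd.1, hd.2.1, fun r hr => hd.2.2 r (hr.imp_right (@hFG _))⟩⟩

/-- The effect of a move is local, so it can be made in any configuration that agrees on what is
read. -/
theorem Move.transfer {p : Fin n} {F : Finset (Fin n)} {c c' d : A.Config}
    {H : List (Event n Op Ret)} (h : Move p F c H c') (hd : AgreeOn p F c d) :
    Move p F d H (splice p c' d) := by
  refine ⟨agreeOff_splice p c' d, fun e he H₀ h₀ => ?_⟩
  have : splice p (splice p c' d) e = splice p c' e := by
    refine Config.ext' (fun r => ?_) (fun x => ?_) (fun x => ?_)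
    · by_cases hr : A.owner r = p <;> simp [splice, hr]
    · by_cases hx : x = p <;> simp [splice, hx]
    · by_cases hx : x = p <;> simp [splice, hx]
  rw [this]
  exact h.2 e ⟨hd.1.trans he.1, hd.2.1.trans he.2.1,
    fun r hr => (hd.2.2 r hr).trans (he.2.2 r hr)⟩ H₀ h₀

theorem Move.trans {p : Fin n} {F : Finset (Fin n)} {c c' c'' : A.Config}
    {H H' : List (Event n Op Ret)} (h : Move p F c H c') (h' : Move p F c' H' c'') :
    Move p F c (H ++ H') c'' := by
  refine ⟨⟨fun x hx => ⟨(h.1.1 x hx).1.trans (h'.1.1 x hx).1, (h.1.1 x hx).2.trans (h'.1.1 x hx).2⟩,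
    fun r hr => (h.1.2 r hr).trans (h'.1.2 r hr)⟩, fun d hd H₀ h₀ => ?_⟩
  have h1 := h.2 d hd H₀ h₀
  have h2 := h'.2 (splice p c' d) ⟨by simp [splice], by simp [splice], fun r hr => ?_⟩ _ h1
  · have : splice p c'' (splice p c' d) = splice p c'' d := by
      refine Config.ext' (fun r => ?_) (fun x => ?_) (fun x => ?_)
      · by_cases hr : A.owner r = p <;> simp [splice, hr]
      · by_cases hx : x = p <;> simp [splice, hx]
      · by_cases hx : x = p <;> simp [splice, hx]
    rwa [this, List.append_assoc] at h2
  -- Registers of `p` come from `c'`; all others are unchanged by the first move, so `d` still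
  -- agrees with `c'` on them.
  · by_cases hrp : A.owner r = p
    · simp [splice, hrp]
    · simp [splice, hrp, ← h.1.2 r hrp, hd.2.2 r hr]

/-- After a step of `p`, a process `q` that does not read `p` still sees the same. -/
theorem AgreeOff.agreeOn {p q : Fin n} {G : Finset (Fin n)} {c c' : A.Config}
    (h : AgreeOff p c c') (hpq : p ≠ q) (hG : p ∉ G) : AgreeOn q G c c' := by
  refine ⟨(h.1 q hpq.symm).1, (h.1 q hpq.symm).2, fun r hr => h.2 r ?_⟩
  rintro rfl
  exact hr.elim (fun e => hpq e) hG

theorem AgreeOn.symm {p : Fin n} {F : Finset (Fin n)} {c d : A.Config} (h : AgreeOn p F c d) :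
    AgreeOn p F d c :=
  ⟨h.1.symm, h.2.1.symm, fun r hr => (h.2.2 r hr).symm⟩

/-- Moves of two processes that do not read each other commute. -/
theorem Move.swap {p q : Fin n} {F G : Finset (Fin n)} {c c₁ c₂ : A.Config}
    {H H' : List (Event n Op Ret)} (h : Move p F c H c₁) (h' : Move q G c₁ H' c₂)
    (hpq : p ≠ q) (hp : p ∉ G) (hq : q ∉ F) :
    ∃ d, Move q G c H' d ∧ Move p F d H c₂ := by
  refine ⟨splice q c₂ c, h'.transfer (h.1.agreeOn hpq hp).symm, ?_⟩
  have h1 := h.transfer ((agreeOff_splice q c₂ c).agreeOn hpq.symm hq)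
  have : splice p c₁ (splice q c₂ c) = c₂ := by
    refine Config.ext' (fun r => ?_) (fun x => ?_) (fun x => ?_)
    · by_cases hr : A.owner r = p
      · simp [splice, hr, h'.1.2 r (by rw [hr]; exact hpq)]
      · by_cases hr' : A.owner r = q
        · simp [splice, hr', hpq.symm]
        · simp [splice, hr, hr', h.1.2 r hr, h'.1.2 r hr']
    · by_cases hx : x = p
      · simp [splice, hx, (h'.1.1 p hpq).1]
      · by_cases hx' : x = q
        · simp [splice, hx', hpq.symm]
        · simp [splice, hx, hx', (h.1.1 x hx).1, (h'.1.1 x hx').1]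
    · by_cases hx : x = p
      · simp [splice, hx, (h'.1.1 p hpq).2]
      · by_cases hx' : x = q
        · simp [splice, hx', hpq.symm]
        · simp [splice, hx, hx', (h.1.1 x hx).2, (h'.1.1 x hx').2]
  rwa [this] at h1

/-! ### Steps and complete operations as moves -/

/-- A step that is determined by the private part of `p` and the registers that it sees is a
move. -/
theorem Move.of_step {p : Fin n} {F : Finset (Fin n)} {c c' : A.Config} {e : Option (Event n Op Ret)}
    (hoff : AgreeOff p c c') (h : ∀ d, AgreeOn p F c d → A.Step d e (splice p c' d)) :
    Move p F c e.toList c' :=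
  ⟨hoff, fun d hd _ h₀ => h₀.step (h d hd)⟩

theorem move_invoke (c : A.Config) (p : Fin n) (o : Op) (hp : c.pending p = none) :
    ∃ c', Move p ∅ c [.inv p o] c' ∧ c'.pending p = some ⟨o, 0, 0⟩ := by
  refine ⟨⟨c.reg, Function.update c.loc p (A.start p (c.loc p) o),
    Function.update c.pending p (some ⟨o, 0, 0⟩)⟩, Move.of_step (e := some (.inv p o)) ?_ ?_, by simp⟩
  · exact ⟨fun x hx => by simp [hx], fun r _ => rfl⟩
  · intro d hd
    convert Step.invoke d p o (hd.2.1 ▸ hp) using 1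
    refine Config.ext' (fun r => ?_) (fun x => ?_) (fun x => ?_)
    · by_cases hr : A.owner r = p
      · simp [splice, hr, hd.2.2 r (.inl hr)]
      · simp [splice, hr]
    · by_cases hx : x = p
      · subst hx; simp [splice, hd.1]
      · simp [splice, hx]
    · by_cases hx : x = p
      · subst hx; simp [splice]
      · simp [splice, hx]

theorem move_respond (c : A.Config) (p : Fin n) (a : Pending Op) (hp : c.pending p = some a)
    (x : Ret) (k : A.State) (hk : A.next p (c.loc p) = .respond x k) :
    ∃ c', Move p ∅ c [.res p x] c' ∧ c'.pending p = none := by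
  refine ⟨⟨c.reg, Function.update c.loc p k, Function.update c.pending p none⟩,
    Move.of_step (e := some (.res p x)) ?_ ?_, by simp⟩
  · exact ⟨fun x hx => by simp [hx], fun r _ => rfl⟩
  · intro d hd
    convert Step.respond d p a (hd.2.1 ▸ hp) x k (hd.1 ▸ hk) using 1
    refine Config.ext' (fun r => ?_) (fun x => ?_) (fun x => ?_)
    · by_cases hr : A.owner r = p
      · simp [splice, hr, hd.2.2 r (.inl hr)]
      · simp [splice, hr]
    · by_cases hx : x = p
      · subst hx; simp [splice]
      · simp [splice, hx]
    · by_cases hx : x = p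
      · subst hx; simp [splice]
      · simp [splice, hx]

/-- A process with a pending operation that is not about to respond can take a step; it reads at most
one register. -/
theorem move_step (c : A.Config) (p : Fin n) (a : Pending Op) (hp : c.pending p = some a)
    (hk : ∀ x k, A.next p (c.loc p) ≠ .respond x k) :
    ∃ (F : Finset (Fin n)) (c' : A.Config) (a' : Pending Op), Move p F c [] c' ∧
      c'.pending p = some a' ∧ a'.op = a.op ∧ a'.steps = a.steps + 1 ∧
      F.card ≤ 1 ∧ F.card + a.accesses ≤ a'.accesses := by
  rcases hn : A.next p (c.loc p) with ⟨r₀, k⟩ | ⟨r₀, own, v, k⟩ | k | ⟨x, k⟩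
  · refine ⟨{A.owner r₀}, ⟨c.reg, Function.update c.loc p (k (c.reg r₀)),
      Function.update c.pending p (some ⟨a.op, a.steps + 1, a.accesses + 1⟩)⟩, _,
      Move.of_step (e := none) ?_ ?_, Function.update_self .., rfl, rfl, by simp, by simp [Nat.add_comm]⟩
    · exact ⟨fun x hx => by simp [hx], fun r _ => rfl⟩
    · intro d hd
      convert Step.read d p a (hd.2.1 ▸ hp) r₀ k (hd.1 ▸ hn) using 1
      refine Config.ext' (fun r => ?_) (fun x => ?_) (fun x => ?_)
      · by_cases hr : A.owner r = p
        · simp [splice, hr, hd.2.2 r (.inl hr)]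
        · simp [splice, hr]
      · by_cases hx : x = p
        · subst hx; simp [splice, hd.2.2 r₀ (.inr (by simp))]
        · simp [splice, hx]
      · by_cases hx : x = p
        · subst hx; simp [splice]
        · simp [splice, hx]
  · classical
    refine ⟨∅, ⟨Function.update c.reg r₀ v, Function.update c.loc p k,
      Function.update c.pending p (some ⟨a.op, a.steps + 1, a.accesses + 1⟩)⟩, _,
      Move.of_step (e := none) ?_ ?_, Function.update_self .., rfl, rfl, by simp, by simp⟩
    · refine ⟨fun x hx => by simp [hx], fun r hr => ?_⟩
      -- The single-writer property: a write changes nothing outside the part of `p`.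
      have : r ≠ r₀ := by rintro rfl; exact hr own
      simp [this]
    · intro d hd
      convert Step.write d p a (hd.2.1 ▸ hp) r₀ own v k (hd.1 ▸ hn) using 1
      refine Config.ext' (fun r => ?_) (fun x => ?_) (fun x => ?_)
      · by_cases hr₀ : r = r₀
        · subst hr₀; simp [splice, own]
        · by_cases hr : A.owner r = p
          · simp [splice, hr, hr₀, hd.2.2 r (.inl hr)]
          · simp [splice, hr, hr₀]
      · by_cases hx : x = p
        · subst hx; simp [splice]
        · simp [splice, hx]
      · by_cases hx : x = p
        · subst hx; simp [splice]
        · simp [splice, hx]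
  · refine ⟨∅, ⟨c.reg, Function.update c.loc p k,
      Function.update c.pending p (some ⟨a.op, a.steps + 1, a.accesses⟩)⟩, _,
      Move.of_step (e := none) ?_ ?_, Function.update_self .., rfl, rfl, by simp, by simp⟩
    · exact ⟨fun x hx => by simp [hx], fun r _ => rfl⟩
    · intro d hd
      convert Step.compute d p a (hd.2.1 ▸ hp) k (hd.1 ▸ hn) using 1
      refine Config.ext' (fun r => ?_) (fun x => ?_) (fun x => ?_)
      · by_cases hr : A.owner r = p
        · simp [splice, hr, hd.2.2 r (.inl hr)]
        · simp [splice, hr]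
      · by_cases hx : x = p
        · subst hx; simp [splice]
        · simp [splice, hx]
      · by_cases hx : x = p
        · subst hx; simp [splice]
        · simp [splice, hx]
  · exact absurd hn (hk x k)

/-- A pending operation of bounded step complexity can be completed by its process alone; it reads at
most as many registers as it accesses. -/
theorem exists_move_complete {o : Op} {B K : ℕ}
    (hB : ∀ (H : List (Event n Op Ret)) (c : A.Config), A.Exec H c →
      ∀ (p : Fin n) (a : Pending Op), c.pending p = some a → a.op = o →
        a.steps ≤ B ∧ a.accesses ≤ K) (p : Fin n) :
    ∀ (t : ℕ) (H : List (Event n Op Ret)) (c : A.Config) (a : Pending Op), A.Exec H c →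
      c.pending p = some a → a.op = o → B < a.steps + t →
      ∃ (F : Finset (Fin n)) (c' : A.Config) (x : Ret), Move p F c [.res p x] c' ∧
        c'.pending p = none ∧ F.card + a.accesses ≤ K := by
  intro t
  -- `t` is a budget: `B < a.steps + t` says that the operation must respond before `t` runs out.
  induction t with
  | zero =>
    intro H c a hH hp ho ht
    exact absurd (hB H c hH p a hp ho).1 (by omega)
  | succ t ih =>
    intro H c a hH hp ho ht
    by_cases hk : ∃ x k, A.next p (c.loc p) = .respond x k
    · obtain ⟨x, k, hk⟩ := hk
      obtain ⟨c', hm, hc'⟩ := move_respond c p a hp x k hk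
      exact ⟨∅, c', x, hm, hc', by simpa using (hB H c hH p a hp ho).2⟩
    · push Not at hk
      obtain ⟨F, c₁, a₁, hm, hp₁, ho₁, hs₁, -, hF⟩ := move_step c p a hp hk
      obtain ⟨G, c', x, hm', hc', hG⟩ := ih _ c₁ a₁ (hm.exec hH) hp₁ (ho₁.trans ho) (by omega)
      refine ⟨F ∪ G, c', x, (hm.mono Finset.subset_union_left).trans
        (hm'.mono Finset.subset_union_right), hc', ?_⟩
      have := Finset.card_union_le F G
      omega

theorem exists_move_operation {o : Op} {B K : ℕ}
    (hB : ∀ (H : List (Event n Op Ret)) (c : A.Config), A.Exec H c →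
      ∀ (p : Fin n) (a : Pending Op), c.pending p = some a → a.op = o →
        a.steps ≤ B ∧ a.accesses ≤ K) (p : Fin n)
    {H : List (Event n Op Ret)} {c : A.Config} (hH : A.Exec H c) (hp : c.pending p = none) :
    ∃ (F : Finset (Fin n)) (c' : A.Config) (x : Ret), Move p F c [.inv p o, .res p x] c' ∧
        c'.pending p = none ∧ F.card ≤ K := by
  obtain ⟨c₁, hm, hp₁⟩ := move_invoke c p o hp
  obtain ⟨F, c', x, hm', hc', hF⟩ :=
    exists_move_complete hB p (B + 1) _ c₁ _ (hm.exec hH) hp₁ rfl (by simp)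
  exact ⟨F, c', x, (hm.mono (by simp)).trans hm', hc', by simpa using hF⟩

/-- The configuration after the processes in the list `M` have invoked `o`. -/
def invokeAll (o : Op) (M : List (Fin n)) (c : A.Config) : A.Config where
  reg := c.reg
  loc x := if x ∈ M then A.start x (c.loc x) o else c.loc x
  pending x := if x ∈ M then some ⟨o, 0, 0⟩ else c.pending x

theorem exec_invokeAll (o : Op) : ∀ (M : List (Fin n)) (c : A.Config)
    (H : List (Event n Op Ret)), A.Exec H c → M.Nodup → (∀ p ∈ M, c.pending p = none) →
      A.Exec (H ++ M.map fun p => .inv p o) (invokeAll o M c) := by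
  intro M
  induction M with
  | nil =>
    intro c H hH _ _
    simpa [invokeAll] using hH
  | cons p M ih =>
    intro c H hH hM hc
    rw [List.nodup_cons] at hM
    have h1 := hH.step (Step.invoke c p o (hc p (by simp)))
    have h2 := ih _ _ h1 hM.2 (fun q hq => by
      have : q ≠ p := by rintro rfl; exact hM.1 hq
      simpa [this] using hc q (by simp [hq]))
    convert h2 using 1
    · simp
    · refine Config.ext' (fun r => rfl) (fun x => ?_) (fun x => ?_)
      · by_cases hx : x = p
        · subst hx; simp [invokeAll, hM.1]
        · simp [invokeAll, hx]
      · by_cases hx : x = p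
        · subst hx; simp [invokeAll]
        · simp [invokeAll, hx]

end Algorithm

end SharedMemory

/-! ### What linearizability says about the value of a read -/

namespace SharedMemory

variable {n : ℕ}

/-- The amount that is added by the operation that an event invokes. -/
def Event.amount {Ret : Type} : Event n CounterOp Ret → ℕ
  | .inv _ o => o.amount
  | .res _ _ => 0

/-- The history of a complete update by process `u.1`, of amount `u.1 + 1`. -/
def updateHistory (u : Fin n × CounterRet) : List (Event n CounterOp CounterRet) :=
  [.inv u.1 (.update (u.1 + 1)), .res u.1 u.2]

/-- The total amount of a sequence of updates. -/
def total (us : List (Fin n × CounterRet)) : ℕ := (us.map fun u => (u.1 : ℕ) + 1).sum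

open Classical in
/-- The total amount that is added by the operations of `H` invoked at positions in `T`. -/
noncomputable def amountOn (H : List (Event n CounterOp CounterRet)) (T : ℕ → Prop) : ℕ :=
  ((List.range H.length).map fun j => if T j then (H[j]?.elim 0 Event.amount) else 0).sum

theorem amountOn_append (H H' : List (Event n CounterOp CounterRet)) (T : ℕ → Prop) :
    amountOn (H ++ H') T = amountOn H T + amountOn H' (fun j => T (H.length + j)) := by
  unfold amountOn
  rw [List.length_append, List.range_add, List.map_append, List.sum_append, List.map_map]
  congr 2
  · refine List.map_congr_left fun j hj => ?_
    rw [List.getElem?_append_left (by simpa using hj)]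
  · refine List.map_congr_left fun j _ => ?_
    simp only [Function.comp]
    rw [List.getElem?_append_right (by omega)]
    simp

theorem amountOn_eq_zero {H : List (Event n CounterOp CounterRet)} {T : ℕ → Prop}
    (h : ∀ j e, H[j]? = some e → T j → e.amount = 0) : amountOn H T = 0 := by
  unfold amountOn
  refine List.sum_eq_zero fun x hx => ?_
  obtain ⟨j, -, rfl⟩ := List.mem_map.1 hx
  split_ifs with hT
  · cases hj : H[j]? with
    | none => rfl
    | some e => exact h j e hj hT
  · rfl

open Classical in
theorem amountOn_updateHistory (u : Fin n × CounterRet) (T : ℕ → Prop) :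
    amountOn (updateHistory u) T = if T 0 then (u.1 : ℕ) + 1 else 0 := by
  simp [amountOn, updateHistory, List.range_succ, Event.amount, CounterOp.amount]

/-- The sum of the amounts of distinct operations of `H`. -/
theorem sum_amount_eq_amountOn {H : List (Event n CounterOp CounterRet)}
    {L : List (ℕ × SeqOp n CounterOp CounterRet)} (hn : (L.map Prod.fst).Nodup)
    (hL : ∀ x ∈ L, H[x.1]? = some (.inv x.2.proc x.2.op)) :
    (L.map fun x => x.2.op.amount).sum = amountOn H (fun j => j ∈ L.map Prod.fst) := by
  classical
  have h1 : (L.map fun x => x.2.op.amount) =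
      (L.map Prod.fst).map fun j => H[j]?.elim 0 Event.amount := by
    rw [List.map_map]
    refine List.map_congr_left fun x hx => ?_
    simp [hL x hx, Event.amount]
  rw [h1, ← List.sum_toFinset _ hn, amountOn, ← List.sum_toFinset _ List.nodup_range]
  refine Finset.sum_subset_zero_on_sdiff (fun j hj => ?_) (fun j hj => if_neg ?_)
    (fun j hj => (if_pos (List.mem_toFinset.1 hj)).symm)
  · obtain ⟨x, hx, rfl⟩ := List.mem_map.1 (List.mem_toFinset.1 hj)
    exact List.mem_toFinset.2 (List.mem_range.2 (List.getElem?_eq_some_iff.1 (hL x hx)).1)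
  · simpa using (Finset.mem_sdiff.1 hj).2

theorem returns_append_update (X Y : List (Event n CounterOp CounterRet)) (u : Fin n × CounterRet) :
    Returns (X ++ updateHistory u ++ Y) X.length (X.length + 1) u.2 :=
  ⟨u.1, .update (u.1 + 1), by simp [updateHistory], by simp [updateHistory], by omega,
    fun k h1 h2 => by omega⟩

/-- A set of operations that is closed under predecessors contains an initial segment of a block of
consecutive updates. -/
theorem exists_amountOn_flatMap {H : List (Event n CounterOp CounterRet)} {T : ℕ → Prop}
    (hT : ∀ i j, T j → Precedes H i j → (∃ k r, Returns H i k r) → T i)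
    (Y : List (Event n CounterOp CounterRet)) :
    ∀ (us : List (Fin n × CounterRet)) (X : List (Event n CounterOp CounterRet)),
      H = X ++ us.flatMap updateHistory ++ Y →
      ∃ t, amountOn (us.flatMap updateHistory) (fun j => T (X.length + j)) = total (us.take t) := by
  intro us
  induction us with
  | nil => exact fun X _ => ⟨0, by simp [amountOn, total]⟩
  | cons u us ih =>
    intro X hH
    have hH' : H = X ++ updateHistory u ++ (us.flatMap updateHistory ++ Y) := by
      rw [hH]; simp
    have hret : Returns H X.length (X.length + 1) u.2 := by
      rw [hH']; exact returns_append_update _ _ _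
    rw [List.flatMap_cons, amountOn_append, amountOn_updateHistory]
    by_cases h0 : T X.length
    · obtain ⟨t, ht⟩ := ih (X ++ updateHistory u) (by rw [hH']; simp)
      refine ⟨t + 1, ?_⟩
      simp only [List.length_append, add_assoc] at ht
      rw [ht]
      simp [h0, total]
    -- The first update is not in `T` and precedes all later ones, so by closure none of these is in
    -- `T`.
    · refine ⟨0, ?_⟩
      rw [amountOn_eq_zero]
      · simp [h0, total]
      · intro j e _ hj
        exact absurd (hT _ _ hj ⟨_, _, hret, by simp [updateHistory]; omega⟩ ⟨_, _, hret⟩) h0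

/-- Every update of the block returns before position `N`, so it precedes whatever is invoked at
`N`. Applied with `N` the invocation of a read, it shows that the read counts the whole block. -/
theorem amountOn_flatMap_of_forall {H : List (Event n CounterOp CounterRet)} {T : ℕ → Prop} {N : ℕ}
    (hT : ∀ i, Precedes H i N → (∃ k r, Returns H i k r) → T i)
    (Y : List (Event n CounterOp CounterRet)) :
    ∀ (us : List (Fin n × CounterRet)) (X : List (Event n CounterOp CounterRet)),
      H = X ++ us.flatMap updateHistory ++ Y →
      (X ++ us.flatMap updateHistory).length ≤ N →
      amountOn (us.flatMap updateHistory) (fun j => T (X.length + j)) = total us := by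
  intro us
  induction us with
  | nil => exact fun X _ _ => by simp [amountOn, total]
  | cons u us ih =>
    intro X hH hN
    have hH' : H = X ++ updateHistory u ++ (us.flatMap updateHistory ++ Y) := by
      rw [hH]; simp
    have hret : Returns H X.length (X.length + 1) u.2 := by
      rw [hH']; exact returns_append_update _ _ _
    rw [List.flatMap_cons, amountOn_append, amountOn_updateHistory]
    have h0 : T X.length := hT _ ⟨_, _, hret, by
      simp [updateHistory] at hN; omega⟩ ⟨_, _, hret⟩
    have ht := ih (X ++ updateHistory u) (by rw [hH']; simp) (by simpa using hN)
    simp only [List.length_append, add_assoc] at ht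
    rw [ht]
    simp [h0, total]

/-- A read that is invoked after the updates `as` and returns after the subsequent updates `bs`
returns the total amount of `as` and an initial segment of `bs`. -/
theorem read_value_of_linearizable {as bs : List (Fin n × CounterRet)} {M : List (Fin n)}
    (hM : M.Nodup) {i : Fin n} (hi : i ∈ M) (hbs : ∀ u ∈ bs, u.1 ∉ M) {x : CounterRet}
    (h : HistoryLinearizable (batchedCounter n)
      (as.flatMap updateHistory ++ M.map (fun p => .inv p .read) ++ bs.flatMap updateHistory ++
        [.res i x])) :
    ∃ t, x = .val (total as + total (bs.take t)) := by
  obtain ⟨M₁, M₂, rfl⟩ := List.append_of_mem hi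
  set H : List (Event n CounterOp CounterRet) := as.flatMap updateHistory ++
    (M₁ ++ i :: M₂).map (fun p => .inv p .read) ++ bs.flatMap updateHistory ++ [.res i x] with hH
  obtain ⟨L, hL, hspec⟩ := h
  set X := as.flatMap updateHistory ++ M₁.map (fun p => Event.inv (Ret := CounterRet) p .read) with hX
  set Y := M₂.map (fun p => Event.inv (Ret := CounterRet) p .read) ++ bs.flatMap updateHistory with hY
  have hHX : H = X ++ .inv i .read :: (Y ++ [.res i x]) := by
    simp [hH, hX, hY]
  have hi₂ : i ∉ M₂ := (List.nodup_cons.1 (List.nodup_append.1 hM).2.1).1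
  have hYp : ∀ e ∈ Y, e.proc ≠ i := by
    intro e he
    rcases List.mem_append.1 he with he | he
    · obtain ⟨p, hp, rfl⟩ := List.mem_map.1 he
      rintro rfl
      exact hi₂ hp
    · obtain ⟨u, hu, he⟩ := List.mem_flatMap.1 he
      have : e.proc = u.1 := by
        simp only [updateHistory, List.mem_cons, List.not_mem_nil, or_false] at he
        rcases he with rfl | rfl <;> rfl
      rw [this]
      rintro rfl
      exact hbs u hu hi
  have hret : Returns H X.length (X.length + 1 + Y.length) x := by
    refine ⟨i, .read, by simp [hHX], ?_, by omega, ?_⟩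
    · rw [hHX, List.getElem?_append_right (by omega)]
      rw [show X.length + 1 + Y.length - X.length = Y.length + 1 by omega]
      simp
    · intro k h1 h2 e he
      rw [hHX, List.getElem?_append_right (by omega)] at he
      obtain ⟨k', rfl⟩ : ∃ k', k = X.length + (k' + 1) := ⟨k - X.length - 1, by omega⟩
      simp only [Nat.add_sub_cancel_left, List.getElem?_cons_succ] at he
      rw [List.getElem?_append_left (by omega)] at he
      exact hYp e (List.mem_of_getElem? he)
  obtain ⟨a, ha, hax⟩ := hL.returned _ _ _ hret
  obtain ⟨L₁, L₂, hLL⟩ := List.append_of_mem ha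
  have hop : a.op = .read := by
    have := hL.invoked _ ha
    simp only [hHX, List.getElem?_append_right le_rfl] at this
    simp at this
    exact this.2.symm
  have hval : x = .val (L₁.map fun y => y.2.op.amount).sum := by
    have := hspec L₁.length a (by rw [hLL]; simp)
    rw [hop] at this
    simp only at this
    rw [← hax, this, hLL]
    congr 1
    simp [Function.comp_def]
  have hnd : (L₁.map Prod.fst).Nodup := by
    have := hL.nodup
    rw [hLL, List.map_append] at this
    exact (List.nodup_append.1 this).1
  rw [sum_amount_eq_amountOn (H := H) hnd
    (fun y hy => hL.invoked y (by rw [hLL]; simp [hy]))] at hval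
  -- The operations linearized before the read: `T` contains all of `as` and is closed under
  -- predecessors that return.
  set T : ℕ → Prop := fun j => j ∈ L₁.map Prod.fst with hTdef
  have hpw := hL.order
  rw [hLL, List.pairwise_append] at hpw
  have hirr : ∀ j, ¬ Precedes H j j := by
    rintro j ⟨k, r, ⟨p, o, _, _, hlt, _⟩, hk⟩
    omega
  -- an operation that precedes the read or an operation in `T` is in `T`
  have hmem : ∀ j, (∃ k r, Returns H j k r) → j ∉ L₁.map Prod.fst →
      ∃ b, (j, b) ∈ (X.length, a) :: L₂ := by
    rintro j ⟨k, r, hr⟩ hj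
    obtain ⟨b, hb, -⟩ := hL.returned _ _ _ hr
    rw [hLL, List.mem_append] at hb
    refine ⟨b, hb.resolve_left fun hb => hj (List.mem_map.2 ⟨_, hb, rfl⟩)⟩
  have hT₁ : ∀ j, Precedes H j X.length → (∃ k r, Returns H j k r) → T j := by
    intro j hj hr
    by_contra hn
    obtain ⟨b, hb⟩ := hmem j hr hn
    rcases List.mem_cons.1 hb with hb | hb
    · rw [Prod.mk.injEq] at hb
      rw [hb.1] at hj
      exact hirr _ hj
    · exact (List.pairwise_cons.1 hpw.2.1).1 _ hb hj
  have hT₂ : ∀ j j', T j' → Precedes H j j' → (∃ k r, Returns H j k r) → T j := by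
    intro j j' hj' hp hr
    by_contra hn
    obtain ⟨b, hb⟩ := hmem j hr hn
    obtain ⟨y, hy, rfl⟩ := List.mem_map.1 hj'
    exact hpw.2.2 _ hy _ hb hp
  have ha' := amountOn_flatMap_of_forall hT₁ (Y := (M₁ ++ i :: M₂).map (fun p => .inv p .read) ++
    bs.flatMap updateHistory ++ [.res i x]) as [] (by simp [hH]) (by simp [hX])
  obtain ⟨t, ht⟩ := exists_amountOn_flatMap hT₂ (Y := [.res i x]) bs
    (as.flatMap updateHistory ++ (M₁ ++ i :: M₂).map (fun p => .inv p .read)) (by rw [hH])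
  refine ⟨t, ?_⟩
  rw [hval, hH, amountOn_append, amountOn_append, amountOn_append, ht]
  simp only [List.length_nil, Nat.zero_add] at ha'
  rw [ha', amountOn_eq_zero (H := (M₁ ++ i :: M₂).map _), amountOn_eq_zero (H := [_])]
  · rfl
  · intro j e he _
    obtain rfl : e = .res i x := by simpa using List.mem_of_getElem? he
    rfl
  · intro j e he _
    obtain ⟨p, -, rfl⟩ := List.mem_map.1 (List.mem_of_getElem? he)
    rfl

end SharedMemory

/-! ### Forced return values and the exchange argument -/

namespace SharedMemory

namespace Algorithm

variable {n : ℕ} {A : Algorithm.{u} n CounterOp CounterRet} {M : List (Fin n)}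

/-- The configuration `c` is reached by the updates `as`, the invocations of reads by the processes
in `M`, and the updates `bs`, where the updates have total amount `S`. -/
def IsHistory (M : List (Fin n)) (S : ℕ) (as bs : List (Fin n × CounterRet)) (c : A.Config) : Prop :=
  (∀ u ∈ bs, u.1 ∉ M) ∧ total as + total bs = S ∧
    A.Exec (as.flatMap updateHistory ++ M.map (fun p => .inv p .read) ++
      bs.flatMap updateHistory) c

/-- The only value that a read of a process in `M` that is about to respond in `c` may return is the
total amount `S` of the updates. -/
def Forced (M : List (Fin n)) (S : ℕ) (c : A.Config) : Prop :=
  ∀ x : ℕ, (∀ as bs, IsHistory M S as bs c → ∃ t, x = total as + total (bs.take t)) → x = S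

theorem total_append (us vs : List (Fin n × CounterRet)) :
    total (us ++ vs) = total us + total vs := by
  simp [total]

theorem total_take_le (us : List (Fin n × CounterRet)) (t : ℕ) : total (us.take t) ≤ total us :=
  ((List.take_sublist t us).map _).sum_le_sum fun _ _ => Nat.zero_le _

/-- The extension is required after every `H`, because one configuration is reached by several
histories and all of them are compared later. The case `us = []` covers silent steps of readers. -/
theorem IsHistory.append {S : ℕ} {as bs us : List (Fin n × CounterRet)} {c c' : A.Config}
    (h : IsHistory M S as bs c) (hus : ∀ u ∈ us, u.1 ∉ M)
    (hc : ∀ H, A.Exec H c → A.Exec (H ++ us.flatMap updateHistory) c') :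
    IsHistory M (S + total us) as (bs ++ us) c' := by
  refine ⟨fun u hu => (List.mem_append.1 hu).elim (h.1 u) (hus u), ?_, ?_⟩
  · rw [total_append, ← add_assoc, h.2.1]
  · have := hc _ h.2.2
    rwa [List.append_assoc, ← List.flatMap_append] at this

/-- All processes in `M` have a pending read, those in `Q` are idle, and the last operation is an
update of `p`, which took the system from `D` to `C`; before it the total amount of the updates was
`S`, and the reads must return the total amount after it. -/
structure Stage (M : List (Fin n)) (Q : Finset (Fin n)) (p : Fin n) (F : Finset (Fin n)) (S : ℕ)
    (D C : A.Config) : Prop where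
  hist : ∃ as bs, IsHistory M S as bs D
  move : ∃ r, Move p F D (updateHistory (p, r)) C
  notMem : p ∉ M
  forced : Forced M (S + (p + 1)) C
  idle : ∀ q ∈ Q, C.pending q = none
  reading : ∀ i ∈ M, ∃ a, C.pending i = some a ∧ a.op = .read

section Stage

variable {Q : Finset (Fin n)} {p : Fin n} {F : Finset (Fin n)} {S : ℕ} {D C : A.Config}

theorem Stage.exists_isHistory (h : Stage M Q p F S D C) :
    ∃ as bs, IsHistory M (S + (p + 1)) as bs C := by
  obtain ⟨as, bs, hh⟩ := h.hist
  obtain ⟨r, hr⟩ := h.move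
  have := hh.append (us := [(p, r)]) (c' := C) (by simpa using h.notMem)
    (fun H hH => by simpa using hr.exec hH)
  exact ⟨as, _, by simpa [total] using this⟩

/-- The response depends on `C` alone, so it extends every history that leads to `C`.
Linearizability of all these extensions constrains the same value, which is the premise of `Forced`.
-/
theorem Stage.respond_value (hA : A.IsLinearizable (batchedCounter n)) (hM : M.Nodup)
    (h : Stage M Q p F S D C) {i : Fin n} (hi : i ∈ M) {x : CounterRet} {k : A.State}
    (hx : A.next i (C.loc i) = .respond x k) : x = .val (S + (p + 1)) := by
  obtain ⟨a, ha, -⟩ := h.reading i hi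
  have key : ∀ as bs, IsHistory M (S + (p + 1)) as bs C →
      ∃ t, x = .val (total as + total (bs.take t)) := fun as bs hh =>
    read_value_of_linearizable hM hi hh.1
      (hA _ _ (hh.2.2.step (Step.respond C i a ha x k hx)))
  obtain ⟨as, bs, hh⟩ := h.exists_isHistory
  obtain ⟨t, rfl⟩ := key as bs hh
  rw [h.forced (total as + total (bs.take t)) fun as' bs' hh' => ?_]
  obtain ⟨t', ht'⟩ := key as' bs' hh'
  exact ⟨t', CounterRet.val.inj ht'⟩

/-- A process of `M` makes a move, and then another process `q` an update. The updates of `p` and `q`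
could have been made in the other order, so that the read cannot return the previous total amount. -/
theorem Stage.next (h : Stage M Q p F S D C) {i q : Fin n} {G F' : Finset (Fin n)}
    {C₁ C₂ : A.Config} {r' : CounterRet} (hi : i ∈ M) (hmi : Move i G C [] C₁) (hG : G.card ≤ 1)
    (hC₁ : ∃ a, C₁.pending i = some a ∧ a.op = .read)
    (hmq : Move q F' C₁ (updateHistory (q, r')) C₂) (hC₂ : C₂.pending q = none)
    (hqM : q ∉ M) (hQ : ∀ q ∈ Q, q ∉ M) (hpq : p ≠ q) (hqF : q ∉ F) (hiF : i ∉ F) (hpF' : p ∉ F')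
    (hiF' : i ∉ F') : Stage M Q q F' (S + (p + 1)) C₁ C₂ := by
  obtain ⟨r, hmp⟩ := h.move
  have hip : i ≠ p := by rintro rfl; exact h.notMem hi
  have hiq : i ≠ q := by rintro rfl; exact hqM hi
  refine ⟨?_, ⟨r', hmq⟩, hqM, ?_, ?_, ?_⟩
  · obtain ⟨as, bs, hh⟩ := h.exists_isHistory
    refine ⟨as, _, hh.append (us := []) (by simp) fun H hH => hmi.exec hH⟩
  · intro x hx
    by_contra hne
    -- Every history of `C` extends to one of `C₂` ending with the update of `q`. As `x` is not the
    -- full sum, it is a partial sum without that update, and the old invariant applies.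
    have hxC : x = S + (p + 1) := by
      refine h.forced x fun as bs hh => ?_
      have := hh.append (us := [(q, r')]) (c' := C₂) (by simpa using hqM)
        (fun H hH => by simpa using hmq.exec (hmi.exec hH))
      rw [show total [(q, r')] = q + 1 by simp [total]] at this
      obtain ⟨t, ht⟩ := hx _ _ this
      rcases le_or_gt t bs.length with hl | hl
      · exact ⟨t, by rw [ht, List.take_append_of_le_length hl]⟩
      · rw [List.take_of_length_le (by simpa using hl)] at ht
        exact absurd (ht.trans this.2.1) hne
    -- If `i` reads `p`, it does not read `q`, and the order becomes `q`, `p`, `i`; otherwise it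
    -- becomes `i`, `q`, `p`.
    have hswap : ∀ H, A.Exec H D →
        A.Exec (H ++ [(q, r'), (p, r)].flatMap updateHistory) C₂ := by
      intro H hH
      by_cases hpG : p ∈ G
      · have hqG : q ∉ G := fun hqG => hpq (Finset.card_le_one.1 hG p hpG q hqG)
        obtain ⟨d, hd₁, hd₂⟩ := hmi.swap hmq hiq hiF' hqG
        obtain ⟨d', hd₁', hd₂'⟩ := hmp.swap hd₁ hpq hpF' hqF
        simpa using hd₂.exec (hd₂'.exec (hd₁'.exec hH))
      · obtain ⟨d, hd₁, hd₂⟩ := hmp.swap hmi hip.symm hpG hiF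
        obtain ⟨d', hd₁', hd₂'⟩ := hd₂.swap hmq hpq hpF' hqF
        simpa using hd₂'.exec (hd₁'.exec (hd₁.exec hH))
    obtain ⟨as, bs, hh⟩ := h.hist
    have := hh.append (us := [(q, r'), (p, r)]) (c' := C₂)
      (by simpa using ⟨hqM, h.notMem⟩) hswap
    rw [show S + total [(q, r'), (p, r)] = S + (p + 1) + (q + 1) by simp [total]; omega] at this
    obtain ⟨t, ht⟩ := hx _ _ this
    -- For the swapped history the partial sums are at most `S`, or `S + (q + 1)`, or the full sum;
    -- `S + (p + 1)` is none of these.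
    have hne' : (p : ℕ) ≠ q := fun e => hpq (Fin.ext e)
    have hS := hh.2.1
    rcases le_or_gt t bs.length with hl | hl
    · rw [List.take_append_of_le_length hl] at ht
      have := total_take_le bs t
      omega
    · obtain ⟨s, rfl⟩ : ∃ s, t = bs.length + (s + 1) := ⟨t - bs.length - 1, by omega⟩
      rw [List.take_length_add_append, total_append] at ht
      rcases s with _ | s
      · simp [total] at ht hS
        omega
      · have h2 := this.2.1
        rw [total_append] at h2
        simp at ht
        omega
  · intro q' hq'
    have hiq' : q' ≠ i := by rintro rfl; exact hQ _ hq' hi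
    by_cases hqq : q' = q
    · rw [hqq, hC₂]
    · rw [← (hmq.1.1 q' hqq).2, ← (hmi.1.1 q' hiq').2, h.idle q' hq']
  · intro j hj
    have hjq : j ≠ q := by rintro rfl; exact hqM hj
    rw [← (hmq.1.1 j hjq).2]
    by_cases hji : j = i
    · rw [hji]; exact hC₁
    · rw [← (hmi.1.1 j hji).2]
      exact h.reading j hj

end Stage

/-! ### Read sets of updates and their in-degrees -/

/-- In the configuration `c`, each process `q` in `Q` can make an update alone, reading only registers
of the processes in `R q`, at most `k` in number. -/
def ReadSets (Q : Finset (Fin n)) (k : ℕ) (c : A.Config) (R : Fin n → Finset (Fin n)) : Prop :=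
  ∀ q ∈ Q, (R q).card ≤ k ∧
    ∃ r c', c'.pending q = none ∧ Move q (R q) c (updateHistory (q, r)) c'

/-- Bounded wait-freedom only makes the solo update terminate, with a bound that may depend on its
argument; the size of the read set is controlled by the step complexity. -/
theorem exists_readSets {k : ℕ} (hA : A.BoundedWaitFree)
    (hk : A.stepComplexity CounterOp.updates ≤ k) {Q : Finset (Fin n)}
    {H : List (Event n CounterOp CounterRet)} {c : A.Config} (hc : A.Exec H c)
    (hQ : ∀ q ∈ Q, c.pending q = none) : ∃ R, ReadSets Q k c R := by
  have key : ∀ q, ∃ R : Finset (Fin n), q ∈ Q → R.card ≤ k ∧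
      ∃ r c', c'.pending q = none ∧ Move q R c (updateHistory (q, r)) c' := by
    intro q
    by_cases hq : q ∈ Q
    · obtain ⟨B, hB⟩ := hA (.update (q + 1))
      have hBk : ∀ (H : List (Event n CounterOp CounterRet)) (c : A.Config), A.Exec H c →
          ∀ (p : Fin n) (a : Pending CounterOp), c.pending p = some a → a.op = .update (q + 1) →
            a.steps ≤ B ∧ a.accesses ≤ k := by
        intro H c hH p a hp ha
        have h1 : (a.accesses : ℕ∞) ≤ A.stepComplexity CounterOp.updates :=
          le_iSup_of_le H <| le_iSup_of_le c <| le_iSup_of_le hH <| le_iSup_of_le p <|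
            le_iSup_of_le a <| le_iSup_of_le hp <| le_iSup_of_le (ha ▸ ⟨_, rfl⟩) le_rfl
        exact ⟨hB H c hH p a hp ha, by exact_mod_cast h1.trans hk⟩
      obtain ⟨R, c', x, hm, hc', hR⟩ := exists_move_operation hBk q hc (hQ q hq)
      exact ⟨R, fun _ => ⟨hR, x, c', hc', hm⟩⟩
    · exact ⟨∅, fun h => absurd h hq⟩
  choose R hR using key
  exact ⟨R, hR⟩

/-- Few of the read sets change when few processes notice the difference. -/
theorem ReadSets.exists_of_agreeOn {k : ℕ} {Q B : Finset (Fin n)} {p : Fin n} {c c' : A.Config}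
    {R R' : Fin n → Finset (Fin n)} (h : ReadSets Q k c R) (h' : ReadSets Q k c' R')
    (hB : ∀ q ∈ Q, q ∉ B → p ∉ R q ∧ AgreeOn q (R q) c c') :
    ∃ R'', ReadSets Q k c' R'' ∧ (Q.filter fun q => p ∈ R'' q).card ≤ B.card := by
  -- Outside `B` the old update transfers with its old read set, which avoids `p`; so only members
  -- of `B` can read `p`.
  refine ⟨fun q => if q ∈ B then R' q else R q, fun q hq => ?_, Finset.card_le_card fun q hq => ?_⟩
  · by_cases hqB : q ∈ B
    · simpa [hqB] using h' q hq
    · obtain ⟨h1, r, d, hd, hm⟩ := h q hq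
      simp only [hqB, if_false]
      exact ⟨h1, r, _, by simpa [splice] using hd, hm.transfer (hB q hq hqB).2⟩
  · rw [Finset.mem_filter] at hq
    by_contra hqB
    simp only [hqB, if_false] at hq
    exact (hB q hq.1 hqB).1 hq.2

/-- Less than half of the elements have an in-degree of more than twice the average. -/
theorem two_mul_card_filter_le {α : Type*} [DecidableEq α] {k : ℕ} {Q X : Finset α}
    {R : α → Finset α} (hR : ∀ q ∈ Q, (R q).card ≤ k) :
    2 * (X.filter fun x => 2 * k < (Q.filter fun q => x ∈ R q).card).card ≤ Q.card := by
  set Y := X.filter fun x => 2 * k < (Q.filter fun q => x ∈ R q).card with hY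
  -- Double counting of the pairs with `x ∈ R q` gives `Y.card * (2 * k + 1) ≤ Q.card * k`.
  have h1 : Y.card * (2 * k + 1) ≤ ∑ x ∈ Y, (Q.filter fun q => x ∈ R q).card := by
    rw [← smul_eq_mul]
    exact Finset.card_nsmul_le_sum _ _ _ fun x hx => (Finset.mem_filter.1 hx).2
  have h2 : ∑ x ∈ Y, (Q.filter fun q => x ∈ R q).card = ∑ q ∈ Q, (Y.filter fun x => x ∈ R q).card :=
    Finset.sum_card_bipartiteAbove_eq_sum_card_bipartiteBelow (fun x q => x ∈ R q)
  have h3 : ∑ q ∈ Q, (Y.filter fun x => x ∈ R q).card ≤ Q.card * k := by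
    rw [← smul_eq_mul]
    refine Finset.sum_le_card_nsmul _ _ _ fun q hq => (Finset.card_le_card fun x hx => ?_).trans (hR q hq)
    exact (Finset.mem_filter.1 hx).2
  by_contra hlt
  push Not at hlt
  nlinarith

/-- The number of steps that `i` has taken in its pending operation. -/
def Config.steps (c : A.Config) (i : Fin n) : ℕ := (c.pending i).elim 0 Pending.steps

/-! ### The adversary -/

section Adversary

variable {Q : Finset (Fin n)} {k : ℕ}

/-- Invocations touch no register, so the first update can be made before or after them with the
same result. In the former case it precedes all reads, and they must count it. -/
theorem exists_initial_stage (hA : A.BoundedWaitFree)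
    (hk : A.stepComplexity CounterOp.updates ≤ k) (hM : M.Nodup) (hQM : ∀ q ∈ Q, q ∉ M)
    (hQ : 0 < Q.card) :
    ∃ (p : Fin n) (F : Finset (Fin n)) (S : ℕ) (D C : A.Config) (R : Fin n → Finset (Fin n)),
      Stage M Q p F S D C ∧ F.card ≤ k ∧ ReadSets Q k C R ∧
      (Q.filter fun q => p ∈ R q).card ≤ 4 * k + 1 := by
  have hinit : A.Exec [] A.initial := Exec.initial
  set D : A.Config := invokeAll .read M A.initial with hD
  have hDe : A.Exec (M.map fun p => .inv p .read) D := by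
    simpa using exec_invokeAll .read M _ _ hinit hM fun _ _ => rfl
  have hidle : ∀ q ∈ Q, D.pending q = none := fun q hq => by
    simp [hD, invokeAll, hQM q hq, Algorithm.initial]
  obtain ⟨R, hR⟩ := exists_readSets hA hk hDe hidle
  have hcard := two_mul_card_filter_le (X := Q) fun q hq => (hR q hq).1
  obtain ⟨p, hpQ, hp⟩ : ∃ p ∈ Q, (Q.filter fun q => p ∈ R q).card ≤ 2 * k := by
    by_contra hno
    push Not at hno
    rw [Finset.filter_true_of_mem hno] at hcard
    omega
  obtain ⟨hpc, r, C, hCp, hm⟩ := hR p hpQ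
  have hpM := hQM p hpQ
  have hCQ : ∀ q ∈ Q, C.pending q = none := fun q hq => by
    by_cases hqp : q = p
    · rw [hqp, hCp]
    · rw [← (hm.1.1 q hqp).2, hidle q hq]
  obtain ⟨R', hR'⟩ := exists_readSets hA hk (hm.exec hDe) hCQ
  obtain ⟨R'', hR'', hle⟩ := hR.exists_of_agreeOn (p := p)
    (B := insert p (Q.filter fun q => p ∈ R q)) hR' fun q hq hqB => by
      simp only [Finset.mem_insert, Finset.mem_filter, not_or, not_and] at hqB
      exact ⟨hqB.2 hq, hm.1.agreeOn (Ne.symm hqB.1) (hqB.2 hq)⟩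
  refine ⟨p, R p, 0, D, C, R'', ⟨⟨[], [], by simp, by simp [total], by simpa using hDe⟩, ⟨r, hm⟩, hpM,
    ?_, hCQ, ?_⟩, hpc, hR'', ?_⟩
  -- `C` is also reached by updating first and invoking the reads afterwards, a history with `bs =
  -- []`.
  · intro x hx
    have hm' := hm.transfer (d := A.initial)
      ⟨by simp [hD, invokeAll, hpM], by simp [hD, invokeAll, hpM], fun _ _ => rfl⟩
    have he := exec_invokeAll .read M _ _ (hm'.exec hinit) hM fun q hq => by
      have : q ≠ p := by rintro rfl; exact hpM hq
      simp [splice, this, Algorithm.initial]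
    have hCeq : invokeAll .read M (splice p C A.initial) = C := by
      refine Config.ext' (fun s => ?_) (fun y => ?_) (fun y => ?_)
      · by_cases hs : A.owner s = p
        · simp [invokeAll, splice, hs]
        · simp [invokeAll, splice, hs, ← hm.1.2 s hs, hD]
      · by_cases hy : y = p
        · subst hy; simp [invokeAll, splice, hpM]
        · simp [invokeAll, splice, hy, ← (hm.1.1 y hy).1, hD]
      · by_cases hy : y = p
        · subst hy; simp [invokeAll, splice, hpM]
        · simp [invokeAll, splice, hy, ← (hm.1.1 y hy).2, hD]
    rw [hCeq] at he
    obtain ⟨t, ht⟩ := hx [(p, r)] [] ⟨by simp, by simp [total], by simpa using he⟩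
    simpa [total] using ht
  · intro i hi
    have : i ≠ p := by rintro rfl; exact hpM hi
    rw [← (hm.1.1 i this).2]
    exact ⟨_, by simp [hD, invokeAll, hi]; rfl, rfl⟩
  · have := Finset.card_insert_le p (Q.filter fun q => p ∈ R q)
    omega

/-- There are a process of `M` and one of `Q` with which the execution can be continued. -/
theorem exists_continuation {R : Fin n → Finset (Fin n)} {p : Fin n} {F : Finset (Fin n)}
    {N : Finset (Fin n)} (hR : ∀ q ∈ Q, (R q).card ≤ k) (hF : F.card ≤ k)
    (hp : (Q.filter fun q => p ∈ R q).card ≤ 4 * k + 1) (hNQ : N.card = Q.card)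
    (hQ : 14 * k + 4 < Q.card) :
    ∃ i ∈ N, ∃ q ∈ Q, i ∉ F ∧ p ≠ q ∧ q ∉ F ∧ p ∉ R q ∧ i ∉ R q ∧
      (Q.filter fun q' => q ∈ R q').card ≤ 2 * k ∧ (Q.filter fun q' => i ∈ R q').card ≤ 2 * k := by
  have h1 := two_mul_card_filter_le (X := N) hR
  have h2 := two_mul_card_filter_le (X := Q) hR
  set N' := N.filter fun x => 2 * k < (Q.filter fun q => x ∈ R q).card with hN'
  set Q' := Q.filter fun x => 2 * k < (Q.filter fun q => x ∈ R q).card with hQ'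
  obtain ⟨i, hiN, hi⟩ : ∃ i ∈ N, i ∉ N' ∪ F :=
    Finset.exists_mem_notMem_of_card_lt_card (by
      have := Finset.card_union_le N' F
      omega)
  simp only [hN', Finset.mem_union, Finset.mem_filter, not_or, not_and, not_lt] at hi
  -- Excluded are `p`, at most half of `Q` for high in-degree, `k` elements of `F`, `4 * k + 1`
  -- readers of `p` and `2 * k` readers of `i`. Besides the half these are `7 * k + 2`, whence `14 *
  -- k + 4`.
  obtain ⟨q, hqQ, hq⟩ : ∃ q ∈ Q, q ∉ insert p (Q' ∪ F ∪ (Q.filter fun q => p ∈ R q) ∪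
      (Q.filter fun q => i ∈ R q)) :=
    Finset.exists_mem_notMem_of_card_lt_card (by
      have a1 := Finset.card_insert_le p (Q' ∪ F ∪ (Q.filter fun q => p ∈ R q) ∪
        (Q.filter fun q => i ∈ R q))
      have a2 := Finset.card_union_le (Q' ∪ F ∪ (Q.filter fun q => p ∈ R q))
        (Q.filter fun q => i ∈ R q)
      have a3 := Finset.card_union_le (Q' ∪ F) (Q.filter fun q => p ∈ R q)
      have a4 := Finset.card_union_le Q' F
      have a5 := hi.1 hiN
      omega)
  simp only [hQ', Finset.mem_insert, Finset.mem_union, Finset.mem_filter, not_or, not_and,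
    not_lt] at hq
  obtain ⟨q1, ⟨⟨q2, q3⟩, q4⟩, q5⟩ := hq
  exact ⟨i, hiN, q, hqQ, hi.2, Ne.symm q1, q3, q4 hqQ, q5 hqQ, q2 hqQ, hi.1 hiN⟩

/-- One round of the adversary; the growing sum of reader steps is its measure of progress. -/
theorem exists_next_stage (hlin : A.IsLinearizable (batchedCounter n)) (hA : A.BoundedWaitFree)
    (hk : A.stepComplexity CounterOp.updates ≤ k) (hM : M.Nodup) (hQM : ∀ q ∈ Q, q ∉ M)
    (hNQ : M.toFinset.card = Q.card) (hQ : 14 * k + 4 < Q.card)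
    {p : Fin n} {F : Finset (Fin n)} {S : ℕ} {D C : A.Config} {R : Fin n → Finset (Fin n)}
    (h : Stage M Q p F S D C) (hF : F.card ≤ k) (hR : ReadSets Q k C R)
    (hp : (Q.filter fun q => p ∈ R q).card ≤ 4 * k + 1) :
    ∃ (p' : Fin n) (F' : Finset (Fin n)) (S' : ℕ) (D' C' : A.Config) (R' : Fin n → Finset (Fin n)),
      Stage M Q p' F' S' D' C' ∧ F'.card ≤ k ∧ ReadSets Q k C' R' ∧
      (Q.filter fun q => p' ∈ R' q).card ≤ 4 * k + 1 ∧
      ∑ i ∈ M.toFinset, C.steps i + 1 ≤ ∑ i ∈ M.toFinset, C'.steps i := by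
  obtain ⟨i, hiN, q, hqQ, hiF, hpq, hqF, hpR, hiR, hqd, hid⟩ :=
    exists_continuation (fun q hq => (hR q hq).1) hF hp hNQ hQ
  have hi : i ∈ M := List.mem_toFinset.1 hiN
  have hqM := hQM q hqQ
  have hiq : i ≠ q := by rintro rfl; exact hqM hi
  obtain ⟨a, ha, hao⟩ := h.reading i hi
  obtain ⟨hqc, r', C₂, hC₂, hmq⟩ := hR q hqQ
  -- If `i` is about to respond, let `q` update without a step of `i`. The response is unchanged,
  -- but the two stages force different totals.
  by_cases hresp : ∃ x s, A.next i (C.loc i) = .respond x s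
  · obtain ⟨x, s, hx⟩ := hresp
    have hx' := hx
    rw [(hmq.1.1 i hiq).1] at hx'
    have h' := h.next hi (Move.refl i ∅ C) (by simp) ⟨a, ha, hao⟩ hmq hC₂ hqM hQM hpq hqF hiF hpR hiR
    have e1 := h.respond_value hlin hM hi hx
    have e2 := h'.respond_value hlin hM hi hx'
    rw [e1, CounterRet.val.injEq] at e2
    omega
  · push Not at hresp
    obtain ⟨G, C₁, a', hmi, ha', hao', has', hG, -⟩ := move_step C i a ha hresp
    have hagree : ∀ q', q' ≠ i → i ∉ R q' → AgreeOn q' (R q') C C₁ := fun q' h1 h2 =>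
      hmi.1.agreeOn (Ne.symm h1) h2
    have hmq' := hmq.transfer (hagree q hiq.symm hiR)
    set C' := splice q C₂ C₁ with hC'
    have h' := h.next hi hmi hG ⟨a', ha', hao'.trans hao⟩ hmq' (by simpa [hC', splice] using hC₂)
      hqM hQM hpq hqF hiF hpR hiR
    obtain ⟨as, bs, hh⟩ := h'.exists_isHistory
    obtain ⟨R₁, hR₁⟩ := exists_readSets hA hk hh.2.2 h'.idle
    -- Only `q`, its at most `2 * k` readers and the at most `2 * k` readers of `i` may need new
    -- read sets, which restores the bound `4 * k + 1`.
    obtain ⟨R', hR', hle⟩ := hR.exists_of_agreeOn (p := q)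
      (B := insert q ((Q.filter fun q' => q ∈ R q') ∪ (Q.filter fun q' => i ∈ R q'))) hR₁
      fun q' hq' hB => by
        simp only [Finset.mem_insert, Finset.mem_union, Finset.mem_filter, not_or, not_and] at hB
        have hq'i : q' ≠ i := by rintro rfl; exact hQM _ hq' hi
        have h1 := hagree q' hq'i (hB.2.2 hq')
        have h2 := hmq'.1.agreeOn (Ne.symm hB.1) (hB.2.1 hq')
        exact ⟨hB.2.1 hq', h1.1.trans h2.1, h1.2.1.trans h2.2.1,
          fun s hs => (h1.2.2 s hs).trans (h2.2.2 s hs)⟩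
    refine ⟨q, R q, _, C₁, C', R', h', hqc, hR', ?_, ?_⟩
    · have a1 := Finset.card_insert_le q
        ((Q.filter fun q' => q ∈ R q') ∪ (Q.filter fun q' => i ∈ R q'))
      have a2 := Finset.card_union_le (Q.filter fun q' => q ∈ R q') (Q.filter fun q' => i ∈ R q')
      omega
    · have hsteps : ∀ j ∈ M.toFinset, C'.steps j = C₁.steps j := fun j hj => by
        have : j ≠ q := by rintro rfl; exact hqM (List.mem_toFinset.1 hj)
        rw [Config.steps, Config.steps, (hmq'.1.1 j this).2]
      rw [Finset.sum_congr rfl hsteps, Nat.add_one_le_iff]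
      refine Finset.sum_lt_sum (fun j _ => ?_) ⟨i, hiN, ?_⟩
      · by_cases hj : j = i
        · subst hj; simp [Config.steps, ha, ha', has']
        · rw [Config.steps, Config.steps, (hmi.1.1 j hj).2]
      · simp [Config.steps, ha, ha', has']

/-- With `m` readers and `m` updaters, the step complexity of an update is at least about `m / 14`. -/
theorem card_le_of_stepComplexity_le (hlin : A.IsLinearizable (batchedCounter n))
    (hA : A.BoundedWaitFree) (hk : A.stepComplexity CounterOp.updates ≤ k) (hM : M.Nodup)
    (hQM : ∀ q ∈ Q, q ∉ M) (hNQ : M.toFinset.card = Q.card) : Q.card ≤ 14 * k + 4 := by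
  by_contra! hQ
  obtain ⟨B, hB⟩ := hA .read
  have key : ∀ T : ℕ, ∃ (p : Fin n) (F : Finset (Fin n)) (S : ℕ) (D C : A.Config)
      (R : Fin n → Finset (Fin n)), Stage M Q p F S D C ∧ F.card ≤ k ∧ ReadSets Q k C R ∧
      (Q.filter fun q => p ∈ R q).card ≤ 4 * k + 1 ∧ T ≤ ∑ i ∈ M.toFinset, C.steps i := by
    intro T
    induction T with
    | zero =>
      obtain ⟨p, F, S, D, C, R, h1, h2, h3, h4⟩ := exists_initial_stage hA hk hM hQM (by omega)
      exact ⟨p, F, S, D, C, R, h1, h2, h3, h4, Nat.zero_le _⟩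
    | succ T ih =>
      obtain ⟨p, F, S, D, C, R, h1, h2, h3, h4, h5⟩ := ih
      obtain ⟨p', F', S', D', C', R', h1', h2', h3', h4', h5'⟩ :=
        exists_next_stage hlin hA hk hM hQM hNQ hQ h1 h2 h3 h4
      exact ⟨p', F', S', D', C', R', h1', h2', h3', h4', by omega⟩
  -- One step more than the readers can take together within their pending reads.
  obtain ⟨p, F, S, D, C, R, h, -, -, -, hT⟩ := key (M.toFinset.card * B + 1)
  obtain ⟨as, bs, hh⟩ := h.exists_isHistory
  have : ∑ i ∈ M.toFinset, C.steps i ≤ M.toFinset.card * B := by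
    rw [← smul_eq_mul]
    refine Finset.sum_le_card_nsmul _ _ _ fun i hi => ?_
    obtain ⟨a, ha, hao⟩ := h.reading i (List.mem_toFinset.1 hi)
    simpa [Config.steps, ha] using hB _ _ hh.2.2 i a ha hao
  omega

end Adversary

end Algorithm

end SharedMemory

/-! ### The linear lower bound -/

theorem mainTheorem3 :
    ∃ c : ℝ≥0, 0 < c ∧ ∃ N : ℕ, ∀ n : ℕ, N ≤ n →
      ∀ A : SharedMemory.Algorithm.{u} n SharedMemory.CounterOp SharedMemory.CounterRet,
        A.IsLinearizable (SharedMemory.batchedCounter n) → A.BoundedWaitFree →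
          (c : ℝ≥0∞) * (n : ℝ≥0∞) ≤
            ((A.stepComplexity SharedMemory.CounterOp.updates : ℕ∞) : ℝ≥0∞) := by
  -- From `n / 2 ≤ 14 * k + 4` one gets `n ≤ 28 * k + 9`, and `n ≥ 100` makes `k` positive; the
  -- constants are not optimized.
  refine ⟨1 / 100, by positivity, 100, fun n hn A hlin hwf => ?_⟩
  rcases eq_or_ne (A.stepComplexity SharedMemory.CounterOp.updates) ⊤ with htop | htop
  · rw [htop]; simp
  obtain ⟨k, hk⟩ := ENat.ne_top_iff_exists.1 htop
  set M : Finset (Fin n) := Finset.univ.filter fun i => i.val < n / 2 with hM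
  -- For odd `n` the last process stays idle, so that `Q` and `M` have equal size.
  set Q : Finset (Fin n) := Finset.univ.filter fun i => n / 2 ≤ i.val ∧ i.val < n / 2 + n / 2 with hQ
  have hMc : M.card = n / 2 := by
    rw [← Finset.card_map Fin.valEmbedding, show M.map Fin.valEmbedding = Finset.range (n / 2) from ?_,
      Finset.card_range]
    ext j
    simp only [hM, Finset.mem_map, Finset.mem_filter, Finset.mem_univ, true_and, Finset.mem_range]
    exact ⟨by rintro ⟨i, hi, rfl⟩; exact hi, fun hj => ⟨⟨j, by omega⟩, hj, rfl⟩⟩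
  have hQc : Q.card = n / 2 := by
    rw [← Finset.card_map Fin.valEmbedding,
      show Q.map Fin.valEmbedding = Finset.Ico (n / 2) (n / 2 + n / 2) from ?_, Nat.card_Ico]
    · omega
    ext j
    simp only [hQ, Finset.mem_map, Finset.mem_filter, Finset.mem_univ, true_and, Finset.mem_Ico]
    exact ⟨by rintro ⟨i, hi, rfl⟩; exact hi, fun hj => ⟨⟨j, by omega⟩, hj, rfl⟩⟩
  have hle := SharedMemory.Algorithm.card_le_of_stepComplexity_le (M := M.toList) (Q := Q) hlin hwf
    hk.ge M.nodup_toList (fun q hq => by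
      simp only [hQ, Finset.mem_filter] at hq
      simp only [hM, Finset.mem_toList, Finset.mem_filter]
      omega) (by rw [Finset.toList_toFinset, hMc, hQc])
  rw [hQc] at hle
  have hnk : n ≤ 100 * k := by omega
  rw [← hk]
  have h1 : (1 / 100 : ℝ≥0) * n ≤ k := by
    have : (n : ℝ≥0) ≤ 100 * k := by exact_mod_cast hnk
    calc (1 / 100 : ℝ≥0) * n ≤ (1 / 100) * (100 * k) := by gcongr
      _ = k := by rw [← mul_assoc]; norm_num
  calc (((1 / 100 : ℝ≥0)) : ℝ≥0∞) * (n : ℝ≥0∞) = (((1 / 100 : ℝ≥0) * n : ℝ≥0) : ℝ≥0∞) := by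
        rw [ENNReal.coe_mul, ENNReal.coe_natCast]
    _ ≤ ((k : ℝ≥0) : ℝ≥0∞) := by exact_mod_cast h1
    _ = _ := by simp
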